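/- Let $\Gamma$ be a simplicial graph with vertex set $V\Gamma$ (no loops or multiple edges; possibly infinite) and let $\mathfrak{G}=\{G_u\mid u\in V\Gamma\}$ be a family of groups. For a full subgraph $\Delta$ of $\Gamma$, the graph product $\Delta\mathfrak{G}$ is the quotient of the free product $\ast_{u\in V\Delta}G_u$ by the relations $[g,h]=1$ for all $g\in G_u$, $h\in G_w$ with $\{u,w\}$ an edge of $\Delta$. Let $v\in V\Gamma$, let $\Gamma'=\Gamma-v$ be the full subgraph on $V\Gamma\setminus\{v\}$, and let $\Gamma''$ be the full subgraph of $\Gamma'$ on the neighbours of $v$ in $\Gamma$; $\Gamma''\mathfrak{G}$ is regarded as a subgroup of $\Gamma'\mathfrak{G}$ via the canonical injection. Let $\pi:\Gamma\mathfrak{G}\to\Gamma'\mathfrak{G}$ be the canonical surjection, which is the identity on $G_u$ for $u\neq v$ and trivial on $G_v$. Then for every cyclic subgroup $C$ of $\Gamma'\mathfrak{G}$ there is an isomorphism $$\pi^{-1}(C)\;\cong\;\Bigl(\ast_{\Gamma'\mathfrak{G}/\Gamma''\mathfrak{G}}\,G_v\Bigr)\rtimes C$$ under which $\pi$ corresponds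 to the projection onto $C$. Here the free product consists of one copy of $G_v$ for each left coset in $\Gamma'\mathfrak{G}/\Gamma''\mathfrak{G}$, and $C$ acts on it by permuting the free factors according to left multiplication on cosets: writing $g_s$ for the element $g\in G_v$ in the copy with index $s$, we have $c\cdot g_s=g_{cs}$ for $c\in C$, $g\in G_v$, $s\in\Gamma'\mathfrak{G}/\Gamma''\mathfrak{G}$. -/

import Mathlib

universe u w x y z

/-- The relators of a graph product: all commutators
`[g, h] = g h g⁻¹ h⁻¹` of elements of vertex groups
of adjacent vertices. -/
def GraphProduct.relators {V : Type u} (Γ : SimpleGraph V) (G : V → Type w)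
    [∀ i, Group (G i)] : Set (Monoid.CoprodI G) :=
  {r | ∃ (i j : V) (_ : Γ.Adj i j) (g : G i) (h : G j),
    r = Monoid.CoprodI.of g * Monoid.CoprodI.of h * (Monoid.CoprodI.of g)⁻¹ *
      (Monoid.CoprodI.of h)⁻¹}

/-- The graph product of the groups `G i` over the simplicial graph `Γ`: the quotient of the
free product of all `G i` by the relations `[g, h] = 1` for `g ∈ G i`, `h ∈ G j` and
`i`, `j` adjacent. -/
def GraphProduct {V : Type u} (Γ : SimpleGraph V) (G : V → Type w) [∀ i, Group (G i)] :
    Type (max u w) :=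
  Monoid.CoprodI G ⧸ Subgroup.normalClosure (GraphProduct.relators Γ G)

namespace GraphProduct

instance instGroup {V : Type u} (Γ : SimpleGraph V) (G : V → Type w) [∀ i, Group (G i)] :
    Group (GraphProduct Γ G) :=
  inferInstanceAs (Group (Monoid.CoprodI G ⧸ Subgroup.normalClosure (relators Γ G)))

/-- The canonical homomorphism from a vertex group to the graph product. -/
def of {V : Type u} (Γ : SimpleGraph V) (G : V → Type w) [∀ i, Group (G i)] (i : V) :
    G i →* GraphProduct Γ G :=
  (QuotientGroup.mk' (Subgroup.normalClosure (relators Γ G))).comp Monoid.CoprodI.of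

theorem commute_of {V : Type u} (Γ : SimpleGraph V) (G : V → Type w) [∀ i, Group (G i)]
    {i j : V} (hij : Γ.Adj i j) (g : G i) (h : G j) :
    Commute (of Γ G i g) (of Γ G j h) := by
  have key : of Γ G i g * of Γ G j h * (of Γ G i g)⁻¹ * (of Γ G j h)⁻¹ = 1 :=
    (QuotientGroup.eq_one_iff (N := Subgroup.normalClosure (relators Γ G)) _).2
    (Subgroup.subset_normalClosure ⟨i, j, hij, g, h, rfl⟩)
  exact mul_inv_eq_iff_eq_mul.1 (mul_inv_eq_one.1 key)

/-- The universal property: homomorphisms out of the vertex groups whose images commute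
for adjacent vertices extend to the graph product. -/
def lift {V : Type u} (Γ : SimpleGraph V) (G : V → Type w) [∀ i, Group (G i)]
    {K : Type x} [Group K] (f : ∀ i, G i →* K)
    (hf : ∀ i j, Γ.Adj i j → ∀ (g : G i) (h : G j), Commute (f i g) (f j h)) :
    GraphProduct Γ G →* K :=
  QuotientGroup.lift (Subgroup.normalClosure (relators Γ G)) (Monoid.CoprodI.lift f) (by
    apply Subgroup.normalClosure_le_normal
    rintro r ⟨i, j, hij, g, h, rfl⟩
    have key := (hf i j hij g h).eq
    simp [key])

@[simp]
theorem lift_of {V : Type u} (Γ : SimpleGraph V) (G : V → Type w) [∀ i, Group (G i)]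
    {K : Type x} [Group K] (f : ∀ i, G i →* K)
    (hf : ∀ i j, Γ.Adj i j → ∀ (g : G i) (h : G j), Commute (f i g) (f j h))
    (i : V) (g : G i) : lift Γ G f hf (of Γ G i g) = f i g :=
  (QuotientGroup.lift_mk' _ _ _).trans (Monoid.CoprodI.lift_of _ _)

theorem hom_ext {V : Type u} {Γ : SimpleGraph V} {G : V → Type w} [∀ i, Group (G i)]
    {K : Type x} [Group K] {a b : GraphProduct Γ G →* K}
    (hab : ∀ i g, a (of Γ G i g) = b (of Γ G i g)) : a = b :=
  QuotientGroup.monoidHom_ext _ (Monoid.CoprodI.ext_hom _ _ fun i => MonoidHom.ext (hab i))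

/-- The graph product of the restricted family over the full subgraph on `S`. -/
abbrev Restrict {V : Type u} (Γ : SimpleGraph V) (G : V → Type w) [∀ i, Group (G i)]
    (S : Set V) : Type (max u w) :=
  GraphProduct (Γ.induce S) (fun i : S => G i)

/-- The canonical homomorphism from the graph product over a full subgraph to the whole graph
product; it is injective (`inclusion_injective`). -/
def inclusion {V : Type u} (Γ : SimpleGraph V) (G : V → Type w) [∀ i, Group (G i)]
    (S : Set V) : Restrict Γ G S →* GraphProduct Γ G :=
  lift (Γ.induce S) (fun i : S => G i) (fun i => of Γ G i)
    (fun _ _ hij g h => commute_of Γ G hij g h)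

open Classical in
/-- The canonical surjection of the graph product onto the graph product over the full subgraph
on `S`: it is the identity on `G i` for `i ∈ S` and kills `G i` for `i ∉ S`. -/
noncomputable def retraction {V : Type u} (Γ : SimpleGraph V) (G : V → Type w)
    [∀ i, Group (G i)] (S : Set V) : GraphProduct Γ G →* Restrict Γ G S :=
  lift Γ G
    (fun i => if hi : i ∈ S then of (Γ.induce S) (fun i : S => G i) ⟨i, hi⟩ else 1)
    (by
      intro i j hij g h
      by_cases hi : i ∈ S
      · by_cases hj : j ∈ S
        · simp only [hi, hj, dite_true]
          exact commute_of (Γ.induce S) (fun i : S => G i) (i := ⟨i, hi⟩) (j := ⟨j, hj⟩) hij g h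
        · simp [hj]
      · simp [hi])

theorem retraction_of_mem {V : Type u} (Γ : SimpleGraph V) (G : V → Type w)
    [∀ i, Group (G i)] (S : Set V) (i : S) (g : G i) :
    retraction Γ G S (of Γ G i g) = of (Γ.induce S) (fun i : S => G i) i g := by
  simp [retraction]

theorem retraction_of_notMem {V : Type u} (Γ : SimpleGraph V) (G : V → Type w)
    [∀ i, Group (G i)] (S : Set V) (i : V) (hi : i ∉ S) (g : G i) :
    retraction Γ G S (of Γ G i g) = 1 := by
  simp [retraction, hi]

theorem retraction_inclusion {V : Type u} (Γ : SimpleGraph V) (G : V → Type w)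
    [∀ i, Group (G i)] (S : Set V) (a : Restrict Γ G S) :
    retraction Γ G S (inclusion Γ G S a) = a := by
  have h : (retraction Γ G S).comp (inclusion Γ G S) = MonoidHom.id _ := by
    refine hom_ext fun i g => ?_
    simp only [MonoidHom.comp_apply, MonoidHom.id_apply, inclusion]
    exact retraction_of_mem Γ G S i g
  exact DFunLike.congr_fun h a

theorem inclusion_injective {V : Type u} (Γ : SimpleGraph V) (G : V → Type w)
    [∀ i, Group (G i)] (S : Set V) : Function.Injective (inclusion Γ G S) :=
  Function.LeftInverse.injective (retraction_inclusion Γ G S)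

theorem retraction_surjective {V : Type u} (Γ : SimpleGraph V) (G : V → Type w)
    [∀ i, Group (G i)] (S : Set V) : Function.Surjective (retraction Γ G S) :=
  Function.RightInverse.surjective (retraction_inclusion Γ G S)

/-- `Γ'G`: the graph product over the full subgraph `Γ' = Γ - v`. -/
abbrev DeleteVertex {V : Type u} (Γ : SimpleGraph V) (G : V → Type w) [∀ i, Group (G i)]
    (v : V) : Type (max u w) :=
  Restrict Γ G ({v}ᶜ : Set V)

/-- The canonical surjection `π : ΓG → Γ'G`, where `Γ' = Γ - v`. -/
noncomputable abbrev proj {V : Type u} (Γ : SimpleGraph V) (G : V → Type w)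
    [∀ i, Group (G i)] (v : V) : GraphProduct Γ G →* DeleteVertex Γ G v :=
  retraction Γ G ({v}ᶜ : Set V)

/-- `Γ''G` as a subgroup of `Γ'G`: the image of the (injective) canonical homomorphism from the
graph product over the full subgraph `Γ''` of `Γ' = Γ - v` on the neighbours of `v` in `Γ`. -/
def linkSubgroup {V : Type u} (Γ : SimpleGraph V) (G : V → Type w) [∀ i, Group (G i)] (v : V) :
    Subgroup (DeleteVertex Γ G v) :=
  (inclusion (Γ.induce ({v}ᶜ : Set V)) (fun i : ({v}ᶜ : Set V) => G i)
    {i : ({v}ᶜ : Set V) | Γ.Adj v i}).range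

end GraphProduct

/-- For a group `K` acting on a set `X`, the homomorphism of the free product of copies of `H`
indexed by `X` which sends `h` in the copy `x` to `h` in the copy `k • x`. -/
def freeProductPermHom (K : Type x) (X : Type y) (H : Type z) [Group K] [MulAction K X] [Group H]
    (k : K) : Monoid.CoprodI (fun _ : X => H) →* Monoid.CoprodI (fun _ : X => H) :=
  Monoid.CoprodI.lift fun s => (Monoid.CoprodI.of (M := fun _ : X => H) (i := k • s))

theorem freeProductPermHom_of (K : Type x) (X : Type y) (H : Type z) [Group K] [MulAction K X]
    [Group H] (k : K) (s : X) (h : H) :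
    freeProductPermHom K X H k (Monoid.CoprodI.of (M := fun _ : X => H) (i := s) h) =
      Monoid.CoprodI.of (M := fun _ : X => H) (i := k • s) h :=
  Monoid.CoprodI.lift_of (M := fun _ : X => H) _ h

theorem freeProductPermHom_one (K : Type x) (X : Type y) (H : Type z) [Group K] [MulAction K X]
    [Group H] : freeProductPermHom K X H 1 = MonoidHom.id _ := by
  refine Monoid.CoprodI.ext_hom _ _ fun s => MonoidHom.ext fun h => ?_
  simp only [MonoidHom.comp_apply, MonoidHom.id_apply]
  rw [freeProductPermHom_of, one_smul]

theorem freeProductPermHom_mul (K : Type x) (X : Type y) (H : Type z) [Group K] [MulAction K X]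
    [Group H] (k l : K) : freeProductPermHom K X H (k * l) =
      (freeProductPermHom K X H k).comp (freeProductPermHom K X H l) := by
  refine Monoid.CoprodI.ext_hom _ _ fun s => MonoidHom.ext fun h => ?_
  simp only [MonoidHom.comp_apply]
  rw [freeProductPermHom_of, freeProductPermHom_of, freeProductPermHom_of, mul_smul]

/-- The action of `K` on the free product of copies of `H` indexed by the `K`-set `X` which
permutes the free factors: `k` sends `h` in the copy `x` to `h` in the copy `k • x`. -/
def freeProductPerm (K : Type x) (X : Type y) (H : Type z) [Group K] [MulAction K X] [Group H] :
    K →* MulAut (Monoid.CoprodI (fun _ : X => H)) where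
  toFun k := MonoidHom.toMulEquiv (freeProductPermHom K X H k) (freeProductPermHom K X H k⁻¹)
    (by rw [← freeProductPermHom_mul, inv_mul_cancel, freeProductPermHom_one])
    (by rw [← freeProductPermHom_mul, mul_inv_cancel, freeProductPermHom_one])
  map_one' := MulEquiv.ext fun a => DFunLike.congr_fun (freeProductPermHom_one K X H) a
  map_mul' k l := MulEquiv.ext fun a => DFunLike.congr_fun (freeProductPermHom_mul K X H k l) a

namespace GraphProduct

section

variable {V : Type u} (Γ : SimpleGraph V) (G : V → Type w) [∀ i, Group (G i)] (v : V)

/-! The whole graph product splits as the free product of copies of `G v` over the cosets, extended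
by `Γ'G`. In it, the conjugate of `G v` by an element of `Γ'G` depends only on the coset of that
element, because the link subgroup commutes with `G v` (`commute_of_inclusion_linkSubgroup`).
Conversely, in the semidirect product the link subgroup fixes the copy at the trivial coset, so the
relations of `Γ` hold there. The universal properties of both sides then give `toSemidirect` and
`ofSemidirect`, which are checked on generators to be mutually inverse. Since `π` becomes the right
projection (`toSemidirect_right`), the preimage of `C` consists of the pairs with right component in
`C`. -/

theorem inclusion_of (S : Set V) (i : S) (g : G i) :
    inclusion Γ G S (of (Γ.induce S) (fun i : S => G i) i g) = of Γ G i g :=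
  lift_of (Γ.induce S) (fun i : S => G i) _ _ i g

/-- The free product of copies of `G v` indexed by the cosets of the link subgroup. -/
abbrev CosetCoprod : Type (max u w) :=
  Monoid.CoprodI (fun _ : DeleteVertex Γ G v ⧸ linkSubgroup Γ G v => G v)

/-- The action of `Γ'G` on the free product, permuting the factors. -/
abbrev cosetPerm : DeleteVertex Γ G v →* MulAut (CosetCoprod Γ G v) :=
  freeProductPerm (DeleteVertex Γ G v) (DeleteVertex Γ G v ⧸ linkSubgroup Γ G v) (G v)

/-- The copy of `G v` with index `s`. -/
abbrev cosetOf (s : DeleteVertex Γ G v ⧸ linkSubgroup Γ G v) : G v →* CosetCoprod Γ G v :=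
  Monoid.CoprodI.of (M := fun _ : DeleteVertex Γ G v ⧸ linkSubgroup Γ G v => G v) (i := s)

theorem cosetPerm_of (a : DeleteVertex Γ G v) (s : DeleteVertex Γ G v ⧸ linkSubgroup Γ G v)
    (g : G v) : cosetPerm Γ G v a (cosetOf Γ G v s g) = cosetOf Γ G v (a • s) g :=
  freeProductPermHom_of _ _ _ a s g

theorem of_mem_linkSubgroup (i : ({v}ᶜ : Set V)) (hi : Γ.Adj v i) (g : G i) :
    of (Γ.induce ({v}ᶜ : Set V)) (fun i : ({v}ᶜ : Set V) => G i) i g ∈ linkSubgroup Γ G v :=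
  ⟨of _ _ (⟨i, hi⟩ : {i : ({v}ᶜ : Set V) | Γ.Adj v i}) g,
    inclusion_of _ (fun i : ({v}ᶜ : Set V) => G i) {i : ({v}ᶜ : Set V) | Γ.Adj v i} ⟨i, hi⟩ g⟩

theorem commute_of_inclusion_linkSubgroup {a : DeleteVertex Γ G v}
    (ha : a ∈ linkSubgroup Γ G v) (g : G v) :
    Commute (inclusion Γ G ({v}ᶜ : Set V) a) (of Γ G v g) := by
  obtain ⟨x, rfl⟩ := ha
  let f := (inclusion Γ G ({v}ᶜ : Set V)).comp
    (inclusion (Γ.induce ({v}ᶜ : Set V)) (fun i : ({v}ᶜ : Set V) => G i)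
      {i : ({v}ᶜ : Set V) | Γ.Adj v i})
  -- Stating commutation as an equality of homomorphisms reduces it to generators, that is, to edges
  -- at `v`.
  have hf : (MulAut.conj (of Γ G v g)).toMonoidHom.comp f = f := by
    refine hom_ext fun i h => ?_
    have hi : f (of _ _ i h) = of Γ G i h :=
      (congrArg _ (inclusion_of (Γ.induce ({v}ᶜ : Set V)) (fun i : ({v}ᶜ : Set V) => G i)
        {i : ({v}ᶜ : Set V) | Γ.Adj v i} i h)).trans (inclusion_of Γ G _ i.1 h)
    simp only [MonoidHom.comp_apply, hi, MulEquiv.coe_toMonoidHom, MulAut.conj_apply]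
    exact mul_inv_eq_iff_eq_mul.2 (commute_of Γ G i.2 g h)
  have hx := DFunLike.congr_fun hf x
  simp only [MonoidHom.comp_apply, MulEquiv.coe_toMonoidHom, MulAut.conj_apply] at hx
  exact (mul_inv_eq_iff_eq_mul.1 hx).symm

open Classical in
/-- The vertex homomorphisms into the semidirect product. -/
noncomputable def toSemidirectVertex (i : V) :
    G i →* CosetCoprod Γ G v ⋊[cosetPerm Γ G v] DeleteVertex Γ G v :=
  if hi : i = v then
    SemidirectProduct.inl.comp ((cosetOf Γ G v ((1 : DeleteVertex Γ G v) : _ ⧸ _)).comp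
      (hi ▸ MonoidHom.id (G i)))
  else SemidirectProduct.inr.comp
    (of (Γ.induce ({v}ᶜ : Set V)) (fun i : ({v}ᶜ : Set V) => G i) ⟨i, hi⟩)

theorem toSemidirectVertex_self (g : G v) :
    toSemidirectVertex Γ G v v g =
      SemidirectProduct.inl (cosetOf Γ G v ((1 : DeleteVertex Γ G v) : _ ⧸ _) g) := by
  simp [toSemidirectVertex]

theorem toSemidirectVertex_of_ne {i : V} (hi : i ≠ v) (g : G i) :
    toSemidirectVertex Γ G v i g = SemidirectProduct.inr
      (of (Γ.induce ({v}ᶜ : Set V)) (fun i : ({v}ᶜ : Set V) => G i) ⟨i, hi⟩ g) := by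
  simp [toSemidirectVertex, hi]

/-- Conjugation by `inr` is the action, and a generator at a neighbour of `v` stabilises the trivial
coset. -/
theorem commute_toSemidirectVertex_self {i : V} (hi : Γ.Adj v i) (g : G v) (h : G i) :
    Commute (toSemidirectVertex Γ G v v g) (toSemidirectVertex Γ G v i h) := by
  rw [toSemidirectVertex_self, toSemidirectVertex_of_ne Γ G v hi.ne']
  refine (mul_inv_eq_iff_eq_mul.1 ?_).symm
  rw [← map_inv, ← SemidirectProduct.inl_aut, cosetPerm_of]
  congr 2
  rw [MulAction.Quotient.smul_coe, smul_eq_mul, mul_one]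
  refine congrArg (cosetOf Γ G v) (QuotientGroup.eq.2 ?_)
  rw [mul_one, inv_mem_iff]
  exact of_mem_linkSubgroup Γ G v ⟨i, hi.ne'⟩ hi h

/-- The homomorphism from the graph product to the semidirect product. -/
noncomputable def toSemidirect :
    GraphProduct Γ G →* CosetCoprod Γ G v ⋊[cosetPerm Γ G v] DeleteVertex Γ G v :=
  lift Γ G (toSemidirectVertex Γ G v) (by
    intro i j hij g h
    by_cases hi : i = v
    · subst hi
      exact commute_toSemidirectVertex_self Γ G i hij g h
    by_cases hj : j = v
    · subst hj
      exact (commute_toSemidirectVertex_self Γ G j hij.symm h g).symm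
    rw [toSemidirectVertex_of_ne Γ G v hi, toSemidirectVertex_of_ne Γ G v hj]
    exact (commute_of (Γ.induce ({v}ᶜ : Set V)) (fun i : ({v}ᶜ : Set V) => G i)
      (i := ⟨i, hi⟩) (j := ⟨j, hj⟩) hij g h).map _)

theorem toSemidirect_of_self (g : G v) :
    toSemidirect Γ G v (of Γ G v g) =
      SemidirectProduct.inl (cosetOf Γ G v ((1 : DeleteVertex Γ G v) : _ ⧸ _) g) :=
  (lift_of _ _ _ _ _ _).trans (toSemidirectVertex_self Γ G v g)

theorem toSemidirect_of_ne {i : V} (hi : i ≠ v) (g : G i) :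
    toSemidirect Γ G v (of Γ G i g) = SemidirectProduct.inr
      (of (Γ.induce ({v}ᶜ : Set V)) (fun i : ({v}ᶜ : Set V) => G i) ⟨i, hi⟩ g) :=
  (lift_of _ _ _ _ _ _).trans (toSemidirectVertex_of_ne Γ G v hi g)

theorem toSemidirect_inclusion (a : DeleteVertex Γ G v) :
    toSemidirect Γ G v (inclusion Γ G ({v}ᶜ : Set V) a) = SemidirectProduct.inr a := by
  have h : (toSemidirect Γ G v).comp (inclusion Γ G ({v}ᶜ : Set V)) = SemidirectProduct.inr := by
    refine hom_ext fun i g => ?_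
    rw [MonoidHom.comp_apply, inclusion_of]
    exact toSemidirect_of_ne Γ G v i.2 g
  exact DFunLike.congr_fun h a

theorem toSemidirect_right (x : GraphProduct Γ G) :
    (toSemidirect Γ G v x).right = proj Γ G v x := by
  have h : SemidirectProduct.rightHom.comp (toSemidirect Γ G v) = proj Γ G v := by
    refine hom_ext fun i g => ?_
    rw [MonoidHom.comp_apply]
    by_cases hi : i = v
    · subst hi
      rw [toSemidirect_of_self, SemidirectProduct.rightHom_inl]
      exact (retraction_of_notMem Γ G _ i (by simp) g).symm
    · rw [toSemidirect_of_ne Γ G v hi, SemidirectProduct.rightHom_inr]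
      exact (retraction_of_mem Γ G _ ⟨i, hi⟩ g).symm
  exact DFunLike.congr_fun h x

/-- The copy of `G v` with index `s` goes to the conjugate of `G v` by a representative of `s`. -/
noncomputable def ofCosetCoprod : CosetCoprod Γ G v →* GraphProduct Γ G :=
  Monoid.CoprodI.lift fun s =>
    (MulAut.conj (inclusion Γ G ({v}ᶜ : Set V) s.out)).toMonoidHom.comp (of Γ G v)

/-- Frees the definition from the choice `s.out`: another representative differs by a link element
on the right, which commutes with `G v` and cancels. -/
theorem ofCosetCoprod_of (a : DeleteVertex Γ G v) (g : G v) :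
    ofCosetCoprod Γ G v (cosetOf Γ G v (a : _ ⧸ _) g) =
      inclusion Γ G ({v}ᶜ : Set V) a * of Γ G v g * (inclusion Γ G ({v}ᶜ : Set V) a)⁻¹ := by
  obtain ⟨l, hl⟩ := QuotientGroup.mk_out_eq_mul (linkSubgroup Γ G v) a
  refine (Monoid.CoprodI.lift_of
    (M := fun _ : DeleteVertex Γ G v ⧸ linkSubgroup Γ G v => G v) _ g).trans ?_
  have hc := (commute_of_inclusion_linkSubgroup Γ G v l.2 g).eq
  simp only [MonoidHom.comp_apply, MulEquiv.coe_toMonoidHom, MulAut.conj_apply]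
  rw [hl, map_mul, mul_inv_rev, mul_assoc _ _ (of Γ G v g), hc]
  group

/-- The homomorphism from the semidirect product to the graph product. -/
noncomputable def ofSemidirect :
    CosetCoprod Γ G v ⋊[cosetPerm Γ G v] DeleteVertex Γ G v →* GraphProduct Γ G :=
  SemidirectProduct.lift (ofCosetCoprod Γ G v) (inclusion Γ G ({v}ᶜ : Set V)) (by
    intro a
    refine Monoid.CoprodI.ext_hom _ _ fun s => MonoidHom.ext fun g => ?_
    obtain ⟨b, rfl⟩ := QuotientGroup.mk_surjective s
    simp only [MonoidHom.comp_apply, MulEquiv.coe_toMonoidHom, MulAut.conj_apply]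
    rw [cosetPerm_of, MulAction.Quotient.smul_coe, smul_eq_mul, ofCosetCoprod_of,
      ofCosetCoprod_of, map_mul]
    group)

theorem ofSemidirect_toSemidirect (x : GraphProduct Γ G) :
    ofSemidirect Γ G v (toSemidirect Γ G v x) = x := by
  have h : (ofSemidirect Γ G v).comp (toSemidirect Γ G v) = MonoidHom.id _ := by
    refine hom_ext fun i g => ?_
    rw [MonoidHom.comp_apply, MonoidHom.id_apply]
    by_cases hi : i = v
    · subst hi
      rw [toSemidirect_of_self, ofSemidirect, SemidirectProduct.lift_inl, ofCosetCoprod_of]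
      simp
    · rw [toSemidirect_of_ne Γ G v hi, ofSemidirect, SemidirectProduct.lift_inr]
      exact inclusion_of Γ G _ ⟨i, hi⟩ g
  exact DFunLike.congr_fun h x

theorem toSemidirect_ofSemidirect
    (x : CosetCoprod Γ G v ⋊[cosetPerm Γ G v] DeleteVertex Γ G v) :
    toSemidirect Γ G v (ofSemidirect Γ G v x) = x := by
  have h : (toSemidirect Γ G v).comp (ofSemidirect Γ G v) = MonoidHom.id _ := by
    refine SemidirectProduct.hom_ext ?_ ?_
    · refine Monoid.CoprodI.ext_hom _ _ fun s => MonoidHom.ext fun g => ?_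
      obtain ⟨a, rfl⟩ := QuotientGroup.mk_surjective s
      simp only [MonoidHom.comp_apply, MonoidHom.id_apply]
      -- Conjugating the copy at the trivial coset by `inr a` moves it to the copy at the coset of
      -- `a`.
      rw [ofSemidirect, SemidirectProduct.lift_inl, ofCosetCoprod_of, map_mul, map_mul, map_inv,
        toSemidirect_inclusion, toSemidirect_of_self, ← map_inv, ← SemidirectProduct.inl_aut,
        cosetPerm_of, MulAction.Quotient.smul_coe, smul_eq_mul, mul_one]
    · refine MonoidHom.ext fun a => ?_
      simp only [MonoidHom.comp_apply, MonoidHom.id_apply]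
      rw [ofSemidirect, SemidirectProduct.lift_inr, toSemidirect_inclusion]
  exact DFunLike.congr_fun h x

/-- The isomorphism of the preimage of a subgroup `C` of `Γ'G` with the semidirect product. -/
noncomputable def comapProjEquiv (C : Subgroup (DeleteVertex Γ G v)) :
    C.comap (proj Γ G v) ≃* CosetCoprod Γ G v ⋊[freeProductPerm C
      (DeleteVertex Γ G v ⧸ linkSubgroup Γ G v) (G v)] C where
  toFun a := ⟨(toSemidirect Γ G v a).left, ⟨proj Γ G v a, a.2⟩⟩
  invFun x := ⟨ofSemidirect Γ G v ⟨x.left, x.right⟩, by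
    rw [Subgroup.mem_comap, ← toSemidirect_right, toSemidirect_ofSemidirect]
    exact x.right.2⟩
  left_inv a := by
    refine Subtype.ext ?_
    simp only [← toSemidirect_right]
    exact ofSemidirect_toSemidirect Γ G v a
  right_inv x := by
    refine SemidirectProduct.ext ?_ (Subtype.ext ?_)
    · simp only [toSemidirect_ofSemidirect]
    · simp only [← toSemidirect_right, toSemidirect_ofSemidirect]
  map_mul' a b := by
    refine SemidirectProduct.ext ?_ (Subtype.ext ?_)
    · simp only [Subgroup.coe_mul, map_mul, SemidirectProduct.mul_left, toSemidirect_right]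
      -- The action of `C` is by definition the restriction of that of `Γ'G`.
      rfl
    · simp only [Subgroup.coe_mul, map_mul, SemidirectProduct.mul_right]

end

end GraphProduct

theorem mainTheorem7 {V : Type u} (Γ : SimpleGraph V) (G : V → Type w) [∀ i, Group (G i)] (v : V)
    (C : Subgroup (GraphProduct.DeleteVertex Γ G v)) (hC : IsCyclic C) :
    ∃ e : C.comap (GraphProduct.proj Γ G v) ≃*
        Monoid.CoprodI
            (fun _ : GraphProduct.DeleteVertex Γ G v ⧸ GraphProduct.linkSubgroup Γ G v => G v)
          ⋊[freeProductPerm C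
            (GraphProduct.DeleteVertex Γ G v ⧸ GraphProduct.linkSubgroup Γ G v) (G v)] C,
      ∀ a : C.comap (GraphProduct.proj Γ G v),
        ((e a).right : GraphProduct.DeleteVertex Γ G v) = GraphProduct.proj Γ G v a :=
  ⟨GraphProduct.comapProjEquiv Γ G v C, fun _ => rfl⟩
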